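/- For integers $n\ge 1$ and $d$ let $$p(n,d)=\frac{1}{2^{\,n-1}}\sum_{j=0}^{d-1}\binom{n-1}{j},$$ with $p(n,d)=0$ for $d\le 0$. Call a vector $x\in\mathbf{R}^n$ \emph{positive} if $x_i\ge 0$ for all $i$ and $x_i>0$ for at least one $i$. Let $m,n\ge 1$ and let $A$ be a random $m\times n$ real matrix whose columns $z_1,\dots,z_n$ are independent random vectors in $\mathbf{R}^m$, not necessarily identically distributed, each $z_j$ having a probability density $f_j$ (with respect to Lebesgue measure) that is symmetric with respect to the origin, i.e. $f_j(-z)=f_j(z)$ for all $z$. Then: (0) $p(n,m)$ is the probability that the convex hull of $z_1,\dots,z_n$ does not contain the origin. (1) The probability that $Ax=0$ has a positive solution $x$ is $p(n,n-m)$. (2) For every fixed nonzero $b\in\mathbf{R}^m$, the probability that $Ax=b$ has a positive solution $x$ is $p(n+1,n+1-m)$. (3) The same holds for a random $b$: if $b$ is a random vector in $\mathbf{R}^m$ that is independent of $A$ and almost surely nonzero, then the probability that $Ax=b$ has a positive solution $x$ is $p(n+1,n+1-m)$. -/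

import Mathlib

open MeasureTheory ProbabilityTheory
open scoped Matrix

/-- The number `p(n,d) = 2^{-(n-1)} ∑_{j=0}^{d-1} C(n-1, j)` for `n ≥ 1` and every integer `d`;
the sum is empty, so that `p(n,d) = 0`, when `d ≤ 0`. -/
noncomputable def wendelP (n : ℕ) (d : ℤ) : ℝ :=
  (∑ j ∈ Finset.range d.toNat, ((n - 1).choose j : ℝ)) / 2 ^ (n - 1)

/-- The random vector `X` in `ℝ^m` has a density `f` with respect to Lebesgue measure
that is symmetric with respect to the origin: `f (-z) = f z`. -/
def HasSymmetricDensity {Ω : Type*} [MeasurableSpace Ω] {m : ℕ}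
    (X : Ω → (Fin m → ℝ)) (P : Measure Ω) : Prop :=
  Measurable X ∧ ∃ f : (Fin m → ℝ) → ENNReal,
    Measurable f ∧ (∀ z, f (-z) = f z) ∧ P.map X = volume.withDensity f

/-- A positive vector: all entries are nonnegative and at least one entry is positive. -/
def IsPositiveVector {n : ℕ} (x : Fin n → ℝ) : Prop :=
  (∀ i, 0 ≤ x i) ∧ ∃ i, 0 < x i

/-- The linear system `A x = b` has a positive solution. -/
def HasPositiveSolution {m n : ℕ} (A : Matrix (Fin m) (Fin n) ℝ) (b : Fin m → ℝ) : Prop :=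
  ∃ x : Fin n → ℝ, IsPositiveVector x ∧ A *ᵥ x = b

/-!
The probability that independent symmetric vectors `z₁, …, zₙ` lie in a common open half-space is
computed by randomizing signs. Multiplying each vector by a sign does not change the joint law, so
the probability is the mean, over all sign vectors `ε`, of the probability that the `ε j • z j` lie
in a common open half-space. For a fixed family in general position, the number of such `ε` does not
depend on the family: a point `y` with `ε j * ⟨z j, y⟩ > 0` for all `j` lies in the region of the
hyperplane arrangement `z j ^⊥` with sign vector `ε`, and the number of regions satisfies a
recursion by deleting one hyperplane and by restricting to it (`ite_isRegion_cons_add`,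
`sum_ite_isRegion`). Since the laws are absolutely continuous, the vectors are almost surely in
general position (`ae_inGeneralPosition`).

The sign of one vector may be held fixed: one counts the regions inside an open half-space, which is
one half of the total. This needs neither symmetry nor a density for that vector, only that it is
almost surely nonzero. `measureReal_inOpenHalfspace` is stated in this form and serves both the
columns alone (with the first column in the special role) and the columns together with `-b`.

The linear systems are reduced to half-spaces by Gordan's alternative: `A x = 0` has a positive
solution if and only if the columns do not lie in a common open half-space. For `b ≠ 0` and columns
in general position, `A x = b` has a positive solution if and only if `-b` and the columns do not
lie in a common open half-space (`hasPositiveSolution_iff`); here general position is used when the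
columns alone already satisfy a positive relation, in which case they positively span the space.
The symmetry of the binomial coefficients (`wendelP_add_wendelP_sub`) gives the probability of the
complement.
-/

/-! ### Families in general position -/

/-- A family of vectors is in general position if every subfamily with at most `dim V` members is
linearly independent. -/
def InGeneralPosition {ι V : Type*} [AddCommGroup V] [Module ℝ V] (v : ι → V) : Prop :=
  ∀ s : Finset ι, s.card ≤ Module.finrank ℝ V → LinearIndepOn ℝ v (s : Set ι)

theorem InGeneralPosition.comp {ι κ V : Type*} [AddCommGroup V] [Module ℝ V] {v : ι → V}
    (hv : InGeneralPosition v) {f : κ → ι} (hf : Function.Injective f) :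
    InGeneralPosition (v ∘ f) := by
  classical
  intro s hs
  have h := hv (s.image f) (by rwa [Finset.card_image_of_injective _ hf])
  rw [Finset.coe_image] at h
  exact h.comp_of_image hf.injOn

theorem InGeneralPosition.map {ι V W : Type*} [AddCommGroup V] [Module ℝ V] [AddCommGroup W]
    [Module ℝ W] {v : ι → V} (hv : InGeneralPosition v) (e : V ≃ₗ[ℝ] W) :
    InGeneralPosition (fun i => e (v i)) := by
  intro s hs
  exact (hv s (by rwa [e.finrank_eq])).map_injOn e.toLinearMap e.injective.injOn

theorem InGeneralPosition.ne_zero {ι V : Type*} [AddCommGroup V] [Module ℝ V] {v : ι → V}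
    (hv : InGeneralPosition v) (h : 1 ≤ Module.finrank ℝ V) (i : ι) : v i ≠ 0 := by
  have := hv {i} (by simpa using h)
  exact this.ne_zero (by simp)

/-- Restricting the other members of a linearly independent family of functionals to the kernel of
one of them leaves a linearly independent family. -/
theorem LinearIndepOn.domRestrict_ker {ι V : Type*} [AddCommGroup V] [Module ℝ V]
    {φ : ι → Module.Dual ℝ V} {s : Set ι} {a : ι} (ha : a ∉ s)
    (h : LinearIndepOn ℝ φ (insert a s)) :
    LinearIndepOn ℝ (fun i => (φ i).domRestrict (LinearMap.ker (φ a))) s := by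
  obtain ⟨hs, hspan⟩ := (linearIndepOn_insert ha).1 h
  let r : Module.Dual ℝ V →ₗ[ℝ] Module.Dual ℝ (LinearMap.ker (φ a)) :=
    (LinearMap.ker (φ a)).subtype.dualMap
  have : LinearIndependent ℝ (r ∘ fun i : s => φ i) := by
    refine LinearIndependent.map hs ?_
    rw [Submodule.disjoint_def]
    intro x hx hxr
    -- a functional vanishing on the kernel of `φ a` is a multiple of `φ a`
    have hker : LinearMap.ker (φ a) ≤ LinearMap.ker x := by
      intro y hy
      exact congrArg (fun f => f ⟨y, hy⟩) hxr
    have hmem : x ∈ Submodule.span ℝ (Set.range fun _ : Unit => φ a) :=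
      mem_span_of_iInf_ker_le_ker (by simpa using hker)
    rw [Set.range_const, Submodule.mem_span_singleton] at hmem
    obtain ⟨c, rfl⟩ := hmem
    by_cases hc : c = 0
    · simp [hc]
    · refine absurd ?_ hspan
      have h2 := Submodule.smul_mem _ c⁻¹ hx
      rw [smul_smul, inv_mul_cancel₀ hc, one_smul] at h2
      rwa [Set.image_eq_range]
  exact this

theorem InGeneralPosition.domRestrict_ker {ι κ V : Type*} [AddCommGroup V] [Module ℝ V]
    [FiniteDimensional ℝ V] {φ : ι → Module.Dual ℝ V} (hφ : InGeneralPosition φ) {a : ι}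
    (ha : φ a ≠ 0) {f : κ → ι} (hf : Function.Injective f) (hfa : ∀ k, f k ≠ a) :
    InGeneralPosition fun k => (φ (f k)).domRestrict (LinearMap.ker (φ a)) := by
  classical
  intro s hs
  have hrank := Module.Dual.finrank_ker_add_one_of_ne_zero ha
  rw [Subspace.dual_finrank_eq] at hs
  have hna : a ∉ s.image f := by simpa using fun k _ => hfa k
  have h := hφ (insert a (s.image f)) (by
    rw [Finset.card_insert_of_notMem hna, Finset.card_image_of_injective _ hf,
      Subspace.dual_finrank_eq]
    omega)
  rw [Finset.coe_insert] at h
  have h2 := h.domRestrict_ker (by exact_mod_cast hna)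
  rw [Finset.coe_image] at h2
  exact h2.comp_of_image hf.injOn

/-! ### Regions of a hyperplane arrangement in a half-space -/

/-- Finitely many strict inequalities survive a small perturbation in a given direction. -/
theorem exists_pos_forall_add_mul_pos {ι : Type*} [Finite ι] {a b : ι → ℝ} (ha : ∀ i, 0 < a i) :
    ∃ t : ℝ, 0 < t ∧ ∀ i, 0 < a i + t * b i := by
  have h : ∀ᶠ t in nhdsWithin (0 : ℝ) (Set.Ioi 0), ∀ i, 0 < a i + t * b i := by
    refine Filter.eventually_all.2 fun i => ?_
    have hc : ContinuousAt (fun t : ℝ => a i + t * b i) 0 := by fun_prop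
    exact (hc.eventually (lt_mem_nhds (by simpa using ha i))).filter_mono nhdsWithin_le_nhds
  obtain ⟨t, h1, h2⟩ := (h.and self_mem_nhdsWithin).exists
  exact ⟨t, h2, h1⟩

/-- Sign vectors of `φ` compatible with positivity of `φ₀`: some point `y` makes `φ₀` and all
`ε j • φ j` positive. Such `ε` correspond to the regions cut out by the hyperplanes `φ j = 0` in
the half-space `φ₀ > 0`. -/
def IsRegion {ι V : Type*} [AddCommGroup V] [Module ℝ V] (φ₀ : Module.Dual ℝ V)
    (φ : ι → Module.Dual ℝ V) (ε : ι → ℤˣ) : Prop :=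
  ∃ y, 0 < φ₀ y ∧ ∀ j, 0 < ((ε j : ℤ) : ℝ) * φ j y

/-- Deletion and restriction for a single region: the hyperplane `ψ = 0` cuts a region of the
remaining arrangement in two exactly when it meets it, that is, when the same sign vector is also a
region of the arrangement restricted to that hyperplane. -/
theorem ite_isRegion_cons_add {n : ℕ} {V : Type*} [AddCommGroup V] [Module ℝ V]
    (φ₀ ψ : Module.Dual ℝ V) (hψ : ψ ≠ 0) (φ : Fin n → Module.Dual ℝ V) (ε : Fin n → ℤˣ)
    [∀ ε : Fin (n + 1) → ℤˣ, Decidable (IsRegion φ₀ (Fin.cons ψ φ : Fin (n + 1) → _) ε)]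
    [Decidable (IsRegion φ₀ φ ε)]
    [Decidable (IsRegion (φ₀.domRestrict (LinearMap.ker ψ))
      (fun j => (φ j).domRestrict (LinearMap.ker ψ)) ε)] :
    ((if IsRegion φ₀ (Fin.cons ψ φ : Fin (n + 1) → _) (Fin.cons 1 ε) then 1 else 0) +
      if IsRegion φ₀ (Fin.cons ψ φ : Fin (n + 1) → _) (Fin.cons (-1) ε) then 1 else 0) =
    (if IsRegion φ₀ φ ε then 1 else 0) +
      if IsRegion (φ₀.domRestrict (LinearMap.ker ψ))
        (fun j => (φ j).domRestrict (LinearMap.ker ψ)) ε then 1 else (0 : ℕ) := by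
  have hcons : ∀ u : ℤˣ, IsRegion φ₀ (Fin.cons ψ φ : Fin (n + 1) → _) (Fin.cons u ε) ↔
      ∃ y, 0 < φ₀ y ∧ 0 < ((u : ℤ) : ℝ) * ψ y ∧ ∀ j, 0 < ((ε j : ℤ) : ℝ) * φ j y := by
    intro u
    simp [IsRegion, Fin.forall_fin_succ]
  have hp := hcons 1
  have hm := hcons (-1)
  simp only [Units.val_one, Int.cast_one, one_mul, Units.val_neg, Int.cast_neg, neg_mul,
    Left.neg_pos_iff] at hp hm
  have hker : IsRegion (φ₀.domRestrict (LinearMap.ker ψ))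
      (fun j => (φ j).domRestrict (LinearMap.ker ψ)) ε ↔
      ∃ y, ψ y = 0 ∧ 0 < φ₀ y ∧ ∀ j, 0 < ((ε j : ℤ) : ℝ) * φ j y := by
    simp [IsRegion, and_left_comm]
  by_cases hk : IsRegion (φ₀.domRestrict (LinearMap.ker ψ))
      (fun j => (φ j).domRestrict (LinearMap.ker ψ)) ε
  · obtain ⟨y, hy, hy0, hyj⟩ := hker.1 hk
    obtain ⟨w, hw⟩ : ∃ w, 0 < ψ w := by
      obtain ⟨w, hw⟩ := DFunLike.ne_iff.1 hψ
      rcases lt_or_gt_of_ne hw with h | h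
      · exact ⟨-w, by simpa using h⟩
      · exact ⟨w, by simpa using h⟩
    -- a small step from the hyperplane to either side stays in the region
    have key : ∀ w : V, ∃ t : ℝ, 0 < t ∧ 0 < φ₀ (y + t • w) ∧
        ∀ j, 0 < ((ε j : ℤ) : ℝ) * φ j (y + t • w) := by
      intro w
      obtain ⟨t, ht, h⟩ := exists_pos_forall_add_mul_pos (ι := Option (Fin n))
        (a := fun o => o.elim (φ₀ y) fun j => ((ε j : ℤ) : ℝ) * φ j y)
        (b := fun o => o.elim (φ₀ w) fun j => ((ε j : ℤ) : ℝ) * φ j w)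
        (by rintro (_ | j); exacts [hy0, hyj j])
      refine ⟨t, ht, ?_, fun j => ?_⟩
      · simpa using h none
      · have := h (some j)
        simp only [Option.elim_some] at this
        simp only [map_add, map_smul, smul_eq_mul]
        linarith
    have h1 : IsRegion φ₀ (Fin.cons ψ φ : Fin (n + 1) → _) (Fin.cons 1 ε) := by
      obtain ⟨t, ht, h0, hj⟩ := key w
      refine hp.2 ⟨_, h0, ?_, hj⟩
      simpa [hy] using mul_pos ht hw
    have h2 : IsRegion φ₀ (Fin.cons ψ φ : Fin (n + 1) → _) (Fin.cons (-1) ε) := by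
      obtain ⟨t, ht, h0, hj⟩ := key (-w)
      refine hm.2 ⟨_, h0, ?_, hj⟩
      simpa [hy] using mul_pos ht hw
    have h3 : IsRegion φ₀ φ ε := ⟨y, hy0, hyj⟩
    simp [hk, h1, h2, h3]
  · by_cases hV : IsRegion φ₀ φ ε
    · obtain ⟨y, hy0, hyj⟩ := hV
      have hnot : ¬ (IsRegion φ₀ (Fin.cons ψ φ : Fin (n + 1) → _) (Fin.cons 1 ε) ∧
          IsRegion φ₀ (Fin.cons ψ φ : Fin (n + 1) → _) (Fin.cons (-1) ε)) := by
        rintro ⟨h1, h2⟩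
        obtain ⟨p, hp0, hpψ, hpj⟩ := hp.1 h1
        obtain ⟨q, hq0, hqψ, hqj⟩ := hm.1 h2
        -- the segment from `p` to `q` crosses the hyperplane inside the region
        refine hk (hker.2 ⟨(-ψ q) • p + ψ p • q, ?_, ?_, fun j => ?_⟩)
        · simp; ring
        · have := mul_pos (neg_pos.2 hqψ) hp0
          have := mul_pos hpψ hq0
          simp only [map_add, map_smul, smul_eq_mul]
          linarith
        · have := mul_pos (neg_pos.2 hqψ) (hpj j)
          have := mul_pos hpψ (hqj j)
          simp only [map_add, map_smul, smul_eq_mul]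
          linarith
      have hor : IsRegion φ₀ (Fin.cons ψ φ : Fin (n + 1) → _) (Fin.cons 1 ε) ∨
          IsRegion φ₀ (Fin.cons ψ φ : Fin (n + 1) → _) (Fin.cons (-1) ε) := by
        rcases lt_trichotomy (ψ y) 0 with h | h | h
        · exact Or.inr (hm.2 ⟨y, hy0, h, hyj⟩)
        · exact absurd (hker.2 ⟨y, h, hy0, hyj⟩) hk
        · exact Or.inl (hp.2 ⟨y, hy0, h, hyj⟩)
      have hV : IsRegion φ₀ φ ε := ⟨y, hy0, hyj⟩
      rcases hor with h | h
      · have : ¬ IsRegion φ₀ (Fin.cons ψ φ : Fin (n + 1) → _) (Fin.cons (-1) ε) :=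
          fun h' => hnot ⟨h, h'⟩
        simp [hk, hV, h, this]
      · have : ¬ IsRegion φ₀ (Fin.cons ψ φ : Fin (n + 1) → _) (Fin.cons 1 ε) :=
          fun h' => hnot ⟨h', h⟩
        simp [hk, hV, h, this]
    · have h1 : ¬ IsRegion φ₀ (Fin.cons ψ φ : Fin (n + 1) → _) (Fin.cons 1 ε) := fun h => by
        obtain ⟨y, h0, -, hj⟩ := hp.1 h
        exact hV ⟨y, h0, hj⟩
      have h2 : ¬ IsRegion φ₀ (Fin.cons ψ φ : Fin (n + 1) → _) (Fin.cons (-1) ε) := fun h => by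
        obtain ⟨y, h0, -, hj⟩ := hm.1 h
        exact hV ⟨y, h0, hj⟩
      simp [hk, hV, h1, h2]

theorem sum_range_choose_succ (n d : ℕ) :
    ∑ j ∈ Finset.range (d + 1), (n + 1).choose j =
      ∑ j ∈ Finset.range (d + 1), n.choose j + ∑ j ∈ Finset.range d, n.choose j := by
  rw [Finset.sum_range_succ', Finset.sum_range_succ' (fun j => n.choose j)]
  simp only [Nat.choose_succ_succ, Finset.sum_add_distrib, Nat.choose_zero_right]
  ring

open Classical in
/-- Schläfli's count: `n` hyperplanes in general position cut an open half-space of a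
`d`-dimensional space into `∑_{j<d} C(n, j)` regions. -/
theorem sum_ite_isRegion (n : ℕ) {V : Type*} [AddCommGroup V] [Module ℝ V] [FiniteDimensional ℝ V]
    (φ₀ : Module.Dual ℝ V) (φ : Fin n → Module.Dual ℝ V)
    (h : InGeneralPosition (Fin.cons φ₀ φ : Fin (n + 1) → Module.Dual ℝ V)) :
    ∑ ε : Fin n → ℤˣ, (if IsRegion φ₀ φ ε then 1 else 0) =
      ∑ j ∈ Finset.range (Module.finrank ℝ V), n.choose j := by
  induction n generalizing V with
  | zero =>
    rw [Fintype.sum_unique]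
    rcases Nat.eq_zero_or_pos (Module.finrank ℝ V) with h0 | h0
    · have : Subsingleton V := Module.finrank_zero_iff.1 h0
      have hno : ∀ ε, ¬ IsRegion φ₀ φ ε := by
        rintro ε ⟨y, hy, -⟩
        simp [Subsingleton.elim y 0] at hy
      simp [h0, hno]
    · have hne : φ₀ ≠ 0 := h.ne_zero (by rwa [Subspace.dual_finrank_eq]) 0
      have hyes : ∀ ε, IsRegion φ₀ φ ε := by
        intro ε
        obtain ⟨w, hw⟩ := DFunLike.ne_iff.1 hne
        rcases lt_or_gt_of_ne hw with h | h
        · exact ⟨-w, by simpa using h, fun j => j.elim0⟩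
        · exact ⟨w, by simpa using h, fun j => j.elim0⟩
      obtain ⟨d, hd⟩ := Nat.exists_eq_succ_of_ne_zero h0.ne'
      simp [hyes, hd, Finset.sum_range_succ']
  | succ n ih =>
    rcases Nat.eq_zero_or_pos (Module.finrank ℝ V) with h0 | h0
    · have : Subsingleton V := Module.finrank_zero_iff.1 h0
      have hno : ∀ ε, ¬ IsRegion φ₀ φ ε := by
        rintro ε ⟨y, hy, -⟩
        simp [Subsingleton.elim y 0] at hy
      simp [h0, hno]
    · obtain ⟨ψ, φ, rfl⟩ : ∃ ψ φ', φ = Fin.cons ψ φ' := ⟨_, _, (Fin.cons_self_tail φ).symm⟩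
      have hψ : ψ ≠ 0 := h.ne_zero (by rwa [Subspace.dual_finrank_eq]) 1
      -- index `1` is the position of `ψ`, so `succAbove 1` enumerates the remaining functionals
      have hdel : ∀ k : Fin (n + 1), (Fin.cons φ₀ (Fin.cons ψ φ : Fin (n + 1) → _) :
          Fin (n + 2) → Module.Dual ℝ V) (Fin.succAbove 1 k) =
          (Fin.cons φ₀ φ : Fin (n + 1) → Module.Dual ℝ V) k := by
        intro k
        refine Fin.cases rfl (fun k => ?_) k
        rw [← Fin.succ_zero_eq_one, Fin.succ_succAbove_succ]
        simp
      have h1 : InGeneralPosition (Fin.cons φ₀ φ : Fin (n + 1) → Module.Dual ℝ V) := by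
        have := h.comp (f := Fin.succAbove 1) Fin.succAbove_right_injective
        convert this using 1
        funext k
        exact (hdel k).symm
      have h2 : InGeneralPosition (Fin.cons (φ₀.domRestrict (LinearMap.ker ψ))
          (fun j => (φ j).domRestrict (LinearMap.ker ψ)) :
            Fin (n + 1) → Module.Dual ℝ (LinearMap.ker ψ)) := by
        have := h.domRestrict_ker (a := 1) (f := Fin.succAbove 1) hψ
          Fin.succAbove_right_injective (fun k => Fin.succAbove_ne 1 k)
        simp only [hdel] at this
        have heq : (Fin.cons (φ₀.domRestrict (LinearMap.ker ψ))
            (fun j => (φ j).domRestrict (LinearMap.ker ψ)) :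
              Fin (n + 1) → Module.Dual ℝ (LinearMap.ker ψ)) =
            fun k => ((Fin.cons φ₀ φ : Fin (n + 1) → Module.Dual ℝ V) k).domRestrict
              (LinearMap.ker ψ) := by
          funext k
          exact Fin.cases rfl (fun k => rfl) k
        rw [heq]
        exact this
      have hrank := Module.Dual.finrank_ker_add_one_of_ne_zero hψ
      rw [← (Fin.consEquiv fun _ => ℤˣ).sum_comp, Fintype.sum_prod_type, Finset.sum_comm]
      have hU : (Finset.univ : Finset ℤˣ) = {1, -1} := rfl
      have hne : (1 : ℤˣ) ≠ -1 := by decide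
      simp only [hU, Finset.sum_pair hne]
      calc _ = ∑ ε : Fin n → ℤˣ, ((if IsRegion φ₀ φ ε then 1 else 0) +
            if IsRegion (φ₀.domRestrict (LinearMap.ker ψ))
              (fun j => (φ j).domRestrict (LinearMap.ker ψ)) ε then 1 else (0 : ℕ)) :=
            Finset.sum_congr rfl fun ε _ => ite_isRegion_cons_add φ₀ ψ hψ φ ε
        _ = _ := by
            rw [Finset.sum_add_distrib, ih _ _ h1, ih _ _ h2, ← hrank, sum_range_choose_succ]

/-! ### Gordan's alternative and positive solutions -/

/-- All vectors of the family lie in a common open half-space bounded by a hyperplane through the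
origin. -/
def InOpenHalfspace {ι : Type*} {m : ℕ} (v : ι → Fin m → ℝ) : Prop :=
  ∃ y : Fin m → ℝ, ∀ j, 0 < v j ⬝ᵥ y

theorem inOpenHalfspace_of_zero_notMem_convexHull {ι : Type*} [Finite ι] {m : ℕ}
    {v : ι → Fin m → ℝ} (h : (0 : Fin m → ℝ) ∉ convexHull ℝ (Set.range v)) :
    InOpenHalfspace v := by
  obtain ⟨f, u, h0, hu⟩ := geometric_hahn_banach_point_closed (convex_convexHull ℝ _)
    ((Set.finite_range v).isClosed_convexHull ℝ) h
  refine ⟨(dotProductEquiv ℝ (Fin m)).symm f.toLinearMap, fun j => ?_⟩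
  have h1 : (dotProductEquiv ℝ (Fin m)).symm f.toLinearMap ⬝ᵥ v j = f (v j) :=
    congrArg (fun g : Module.Dual ℝ (Fin m → ℝ) => g (v j))
      ((dotProductEquiv ℝ (Fin m)).apply_symm_apply f.toLinearMap)
  rw [dotProduct_comm, h1]
  rw [map_zero] at h0
  exact h0.trans (hu _ (subset_convexHull ℝ _ ⟨j, rfl⟩))

theorem mulVec_eq_sum_smul_col {m n : ℕ} (A : Matrix (Fin m) (Fin n) ℝ) (x : Fin n → ℝ) :
    A *ᵥ x = ∑ j, x j • A.col j := by
  ext i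
  simp [Matrix.mulVec, dotProduct, mul_comm]

theorem hasPositiveSolution_zero_of_mem_convexHull {m n : ℕ} {A : Matrix (Fin m) (Fin n) ℝ}
    (h : (0 : Fin m → ℝ) ∈ convexHull ℝ (Set.range A.col)) : HasPositiveSolution A 0 := by
  have hsub : convexHull ℝ (Set.range A.col) ⊆ A.mulVecLin '' stdSimplex ℝ (Fin n) := by
    refine convexHull_min ?_ ((convex_stdSimplex ℝ (Fin n)).linear_image _)
    rintro _ ⟨j, rfl⟩
    exact ⟨Pi.single j 1, single_mem_stdSimplex ℝ j, by simp⟩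
  obtain ⟨x, ⟨hx0, hx1⟩, hx⟩ := hsub h
  refine ⟨x, ⟨hx0, ?_⟩, hx⟩
  by_contra! hneg
  have : ∑ j, x j ≤ 0 := Finset.sum_nonpos fun j _ => hneg j
  linarith

theorem HasPositiveSolution.not_inOpenHalfspace {m n : ℕ} {A : Matrix (Fin m) (Fin n) ℝ}
    (h : HasPositiveSolution A 0) : ¬ InOpenHalfspace A.col := by
  rintro ⟨y, hy⟩
  obtain ⟨x, ⟨hx, i, hi⟩, hAx⟩ := h
  have h1 : (A *ᵥ x) ⬝ᵥ y = 0 := by simp [hAx]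
  rw [mulVec_eq_sum_smul_col, sum_dotProduct] at h1
  have h2 : 0 < ∑ j, (x j • A.col j) ⬝ᵥ y := by
    refine Finset.sum_pos' (fun j _ => ?_) ⟨i, Finset.mem_univ _, ?_⟩
    · rw [smul_dotProduct]
      exact mul_nonneg (hx j) (hy j).le
    · rw [smul_dotProduct]
      exact mul_pos hi (hy i)
  exact h2.ne' h1

/-- Gordan's alternative, in terms of the convex hull of the columns. -/
theorem zero_notMem_convexHull_iff {m n : ℕ} (A : Matrix (Fin m) (Fin n) ℝ) :
    (0 : Fin m → ℝ) ∉ convexHull ℝ (Set.range A.col) ↔ InOpenHalfspace A.col :=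
  ⟨inOpenHalfspace_of_zero_notMem_convexHull, fun h h' =>
    (hasPositiveSolution_zero_of_mem_convexHull h').not_inOpenHalfspace h⟩

/-- Gordan's alternative. -/
theorem hasPositiveSolution_zero_iff {m n : ℕ} (A : Matrix (Fin m) (Fin n) ℝ) :
    HasPositiveSolution A 0 ↔ ¬ InOpenHalfspace A.col :=
  ⟨fun h => h.not_inOpenHalfspace, fun h => hasPositiveSolution_zero_of_mem_convexHull
    (by_contra fun h' => h ((zero_notMem_convexHull_iff A).1 h'))⟩

theorem hasPositiveSolution_of_nonneg {m n : ℕ} {A : Matrix (Fin m) (Fin n) ℝ} {b : Fin m → ℝ}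
    (hb : b ≠ 0) {x : Fin n → ℝ} (hx : ∀ j, 0 ≤ x j) (hAx : A *ᵥ x = b) :
    HasPositiveSolution A b := by
  refine ⟨x, ⟨hx, ?_⟩, hAx⟩
  by_contra! hneg
  have : x = 0 := funext fun j => le_antisymm (hneg j) (hx j)
  exact hb (by rw [← hAx, this, Matrix.mulVec_zero])

/-- If the columns are in general position and admit a nontrivial nonnegative relation, then they
positively span the whole space. -/
theorem HasPositiveSolution.of_inGeneralPosition {m n : ℕ} {A : Matrix (Fin m) (Fin n) ℝ}
    (hA : InGeneralPosition A.col) (h : HasPositiveSolution A 0) {b : Fin m → ℝ} (hb : b ≠ 0) :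
    HasPositiveSolution A b := by
  classical
  obtain ⟨x, ⟨hx, i, hi⟩, hAx⟩ := h
  let S : Finset (Fin n) := Finset.univ.filter fun j => 0 < x j
  have hrank : Module.finrank ℝ (Fin m → ℝ) = m := by simp
  have hout : ∀ j, j ∉ S → x j = 0 := fun j hj =>
    le_antisymm (not_lt.1 fun h => hj (by simpa [S] using h)) (hx j)
  -- the support of the relation is dependent, hence has more than `m` elements
  have hcard : m < S.card := by
    by_contra! hle
    have hli := hA S (by rwa [hrank])
    rw [linearIndepOn_finset_iff] at hli
    have hsum : ∑ j ∈ S, x j • A.col j = 0 := by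
      rw [← hAx, mulVec_eq_sum_smul_col]
      exact Finset.sum_subset (Finset.subset_univ _) fun j _ hj => by simp [hout j hj]
    exact hi.ne' (hli x hsum i (by simpa [S] using hi))
  -- any `m` columns in the support form a basis
  obtain ⟨T, hTS, hT⟩ := Finset.exists_subset_card_eq hcard.le
  have hspan : Submodule.span ℝ (A.col '' (T : Set (Fin n))) = ⊤ := by
    rw [Set.image_eq_range]
    exact (hA T (by rw [hrank, hT])).span_eq_top_of_card_eq_finrank' (by simp [hT])
  have hbmem : b ∈ Submodule.span ℝ (A.col '' (T : Set (Fin n))) := hspan ▸ Submodule.mem_top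
  obtain ⟨c, hc⟩ := (Submodule.mem_span_image_finset_iff_exists_fun ℝ).1 hbmem
  let c' : Fin n → ℝ := fun j => if h : j ∈ T then c ⟨j, h⟩ else 0
  have hc' : A *ᵥ c' = b := by
    rw [mulVec_eq_sum_smul_col, ← hc, ← Finset.sum_subset (Finset.subset_univ T)
      fun j _ hj => by simp [c', hj], ← Finset.sum_coe_sort T]
    simp [c']
  -- adding a small multiple of a solution to the relation keeps its support positive
  obtain ⟨t, ht, hpos⟩ := exists_pos_forall_add_mul_pos (ι := S) (a := fun j => x j)
    (b := fun j => c' j) fun j => (Finset.mem_filter.1 j.2).2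
  refine hasPositiveSolution_of_nonneg hb (x := t⁻¹ • (x + t • c')) (fun j => ?_) ?_
  · by_cases hj : j ∈ S
    · exact mul_nonneg (inv_nonneg.2 ht.le) (hpos ⟨j, hj⟩).le
    · have : j ∉ T := fun h => hj (hTS h)
      simp [hout j hj, c', this]
  · rw [Matrix.mulVec_smul, Matrix.mulVec_add, Matrix.mulVec_smul, hAx, hc', zero_add, smul_smul,
      inv_mul_cancel₀ ht.ne', one_smul]

/-- For columns in general position, `A x = b` has a positive solution exactly when `-b` and the
columns do not lie in a common open half-space. -/
theorem hasPositiveSolution_iff {m n : ℕ} {A : Matrix (Fin m) (Fin n) ℝ}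
    (hA : InGeneralPosition A.col) {b : Fin m → ℝ} (hb : b ≠ 0) :
    HasPositiveSolution A b ↔
      ¬ InOpenHalfspace (Fin.cons (-b) A.col : Fin (n + 1) → Fin m → ℝ) := by
  constructor
  · rintro ⟨x, ⟨hx, -⟩, hAx⟩ ⟨y, hy⟩
    have h0 : 0 < (-b) ⬝ᵥ y := hy 0
    have h1 : 0 ≤ (A *ᵥ x) ⬝ᵥ y := by
      rw [mulVec_eq_sum_smul_col, sum_dotProduct]
      refine Finset.sum_nonneg fun j _ => ?_
      rw [smul_dotProduct]
      exact mul_nonneg (hx j) (hy j.succ).le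
    rw [hAx] at h1
    rw [neg_dotProduct] at h0
    linarith
  · intro h
    let B : Matrix (Fin m) (Fin (n + 1)) ℝ :=
      (Matrix.of (Fin.cons (-b) A.col : Fin (n + 1) → Fin m → ℝ))ᵀ
    obtain ⟨x, ⟨hx, i, hi⟩, hBx⟩ := (hasPositiveSolution_zero_iff B).2 h
    have hrel : A *ᵥ (fun j => x j.succ) = x 0 • b := by
      rw [mulVec_eq_sum_smul_col, Fin.sum_univ_succ] at hBx
      have : x 0 • (-b) + ∑ j : Fin n, x j.succ • A.col j = 0 := hBx
      rw [mulVec_eq_sum_smul_col]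
      rw [smul_neg, neg_add_eq_zero] at this
      exact this.symm
    rcases (hx 0).eq_or_lt with h0 | h0
    · have hzero : HasPositiveSolution A 0 := by
        refine ⟨fun j => x j.succ, ⟨fun j => hx _, ?_⟩, by rw [hrel, ← h0, zero_smul]⟩
        obtain rfl | ⟨j, rfl⟩ := Fin.eq_zero_or_eq_succ i
        · exact absurd hi h0.not_lt
        · exact ⟨j, hi⟩
      exact hzero.of_inGeneralPosition hA hb
    · refine hasPositiveSolution_of_nonneg hb (x := (x 0)⁻¹ • fun j => x j.succ)
        (fun j => mul_nonneg (inv_nonneg.2 h0.le) (hx _)) ?_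
      rw [Matrix.mulVec_smul, hrel, smul_smul, inv_mul_cancel₀ h0.ne', one_smul]

/-! ### Wendel's theorem -/

theorem isOpen_setOf_inOpenHalfspace {ι : Type*} [Finite ι] (m : ℕ) :
    IsOpen {v : ι → Fin m → ℝ | InOpenHalfspace v} := by
  have : {v : ι → Fin m → ℝ | InOpenHalfspace v} =
      ⋃ y : Fin m → ℝ, ⋂ j, {v | 0 < v j ⬝ᵥ y} := by
    ext v
    simp [InOpenHalfspace]
  rw [this]
  refine isOpen_iUnion fun y => isOpen_iInter_of_finite fun j => ?_
  refine isOpen_lt continuous_const ?_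
  simp only [dotProduct]
  fun_prop

/-- Independent vectors are almost surely in general position if the first one is almost surely
nonzero and the laws of the others are absolutely continuous. The first law is otherwise arbitrary,
so the vectors have to be added one by one in increasing order of index. -/
theorem ae_inGeneralPosition {m n : ℕ} (μ : Fin (n + 1) → Measure (Fin m → ℝ))
    [∀ j, IsProbabilityMeasure (μ j)] (h0 : μ 0 {0} = 0) (hac : ∀ j : Fin n, μ j.succ ≪ volume) :
    ∀ᵐ v ∂Measure.pi μ, InGeneralPosition v := by
  refine ae_all_iff.2 fun s => ?_
  induction s using Finset.induction_on_max with
  | empty => exact Filter.Eventually.of_forall fun v _ => by simp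
  | insert a s hmax ih =>
    have has : a ∉ s := fun h => lt_irrefl _ (hmax a h)
    rw [Finset.card_insert_of_notMem has]
    by_cases hcard : s.card + 1 ≤ Module.finrank ℝ (Fin m → ℝ)
    swap
    · exact Filter.Eventually.of_forall fun v h => absurd h hcard
    have hindep : IndepFun (fun (v : Fin (n + 1) → Fin m → ℝ) (i : s) => v i) (fun v => v a)
        (Measure.pi μ) := by
      have h1 : iIndepFun (fun (i : Fin (n + 1)) (v : Fin (n + 1) → Fin m → ℝ) => v i)
          (Measure.pi μ) := iIndepFun_pi (X := fun _ x => x) fun _ => measurable_id.aemeasurable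
      have h2 := h1.indepFun_finset s {a} (by simpa using has) fun i => measurable_pi_apply i
      have hψ : Measurable fun w : (({a} : Finset (Fin (n + 1))) → Fin m → ℝ) =>
          w ⟨a, Finset.mem_singleton_self a⟩ := measurable_pi_apply _
      exact h2.comp measurable_id hψ
    have hms : Measurable fun (v : Fin (n + 1) → Fin m → ℝ) (i : s) => v i :=
      measurable_pi_iff.2 fun i => measurable_pi_apply _
    have hma : Measurable fun v : Fin (n + 1) → Fin m → ℝ => v a := measurable_pi_apply a
    have hlaw := (indepFun_iff_map_prod_eq_prod_map_map hms.aemeasurable hma.aemeasurable).1 hindep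
    have hmap : (Measure.pi μ).map (fun v => v a) = μ a := (measurePreserving_eval μ a).map_eq
    rw [hmap] at hlaw
    have hae : ∀ᵐ p : (s → Fin m → ℝ) × (Fin m → ℝ) ∂
        ((Measure.pi μ).map fun (v : Fin (n + 1) → Fin m → ℝ) (i : s) => v i).prod (μ a),
        LinearIndependent ℝ p.1 →
          LinearIndependent ℝ (fun o : Option s => Option.casesOn' o p.2 p.1) := by
      rw [Measure.ae_prod_iff_ae_ae]
      · refine Filter.Eventually.of_forall fun q => ?_
        suffices h : μ a (Submodule.span ℝ (Set.range q)) = 0 by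
          refine Filter.mem_of_superset (compl_mem_ae_iff.2 h) fun p hp hq => ?_
          exact linearIndependent_option'.2 ⟨hq, hp⟩
        obtain rfl | ⟨j, rfl⟩ := Fin.eq_zero_or_eq_succ a
        · -- no index precedes `0`, so the span is trivial
          have hs : IsEmpty s := ⟨fun i => Fin.not_lt_zero _ (hmax i i.2)⟩
          simpa [Set.range_eq_empty] using h0
        · refine hac j (Measure.addHaar_submodule _ _ fun htop => ?_)
          have := finrank_range_le_card (R := ℝ) q
          rw [Set.finrank, htop, finrank_top, Fintype.card_coe] at this
          omega
      · have h1 : MeasurableSet {p : (s → Fin m → ℝ) × (Fin m → ℝ) | LinearIndependent ℝ p.1} :=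
          ((isOpen_setOfPred_linearIndependent (𝕜 := ℝ)).preimage continuous_fst).measurableSet
        have h2 : MeasurableSet {p : (s → Fin m → ℝ) × (Fin m → ℝ) |
            LinearIndependent ℝ (fun o : Option s => Option.casesOn' o p.2 p.1)} := by
          refine ((isOpen_setOfPred_linearIndependent (𝕜 := ℝ)).preimage
            (f := fun p : (s → Fin m → ℝ) × (Fin m → ℝ) =>
              fun o : Option s => Option.casesOn' o p.2 p.1) ?_).measurableSet
          refine continuous_pi fun o => ?_
          cases o with
          | none => exact continuous_snd
          | some i => exact (continuous_apply i).comp continuous_fst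
        exact h1.imp h2
    rw [← hlaw] at hae
    filter_upwards [ih, ae_of_ae_map (hms.prodMk hma).aemeasurable hae] with v hv hv' _
    have hs := hv (by omega)
    have := (linearIndependent_option'.1 (hv' hs)).2
    rw [Finset.coe_insert]
    refine hs.insert ?_
    rwa [Set.image_eq_range]

/-- Changing the signs of some vectors of a family. -/
def signFlip {ι : Type*} {m : ℕ} (σ : ι → ℤˣ) (v : ι → Fin m → ℝ) : ι → Fin m → ℝ :=
  fun j => ((σ j : ℤ) : ℝ) • v j

theorem measurePreserving_signFlip {m n : ℕ} (μ : Fin (n + 1) → Measure (Fin m → ℝ))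
    [∀ j, IsProbabilityMeasure (μ j)] (hsymm : ∀ j : Fin n, (μ j.succ).map (fun z => -z) = μ j.succ)
    (ε : Fin n → ℤˣ) :
    MeasurePreserving (signFlip (Fin.cons 1 ε : Fin (n + 1) → ℤˣ)) (Measure.pi μ)
      (Measure.pi μ) := by
  refine measurePreserving_pi μ μ
    (f := fun j z => (((Fin.cons 1 ε : Fin (n + 1) → ℤˣ) j : ℤ) : ℝ) • z) fun j => ?_
  refine Fin.cases ?_ (fun j => ?_) j
  · simpa [Function.id_def] using MeasurePreserving.id (μ 0)
  · rcases Int.units_eq_one_or (ε j) with h | h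
    · simpa [h, Function.id_def] using MeasurePreserving.id (μ j.succ)
    · simpa [h] using (⟨measurable_neg, hsymm j⟩ :
        MeasurePreserving (fun z : Fin m → ℝ => -z) (μ j.succ) (μ j.succ))

theorem inOpenHalfspace_signFlip_iff {m n : ℕ} (v : Fin (n + 1) → Fin m → ℝ) (ε : Fin n → ℤˣ) :
    InOpenHalfspace (signFlip (Fin.cons 1 ε : Fin (n + 1) → ℤˣ) v) ↔
      IsRegion (dotProductEquiv ℝ (Fin m) (v 0))
        (fun j : Fin n => dotProductEquiv ℝ (Fin m) (v j.succ)) ε := by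
  simp [InOpenHalfspace, IsRegion, Fin.forall_fin_succ, signFlip, smul_dotProduct]

/-- Wendel's theorem, for independent vectors of which the first is only required to be almost
surely nonzero. The first law needs no symmetry: randomizing the signs of the other vectors already
averages over all regions of the half-space that the first vector determines. -/
theorem measureReal_inOpenHalfspace {m n : ℕ} (μ : Fin (n + 1) → Measure (Fin m → ℝ))
    [∀ j, IsProbabilityMeasure (μ j)] (h0 : μ 0 {0} = 0) (hac : ∀ j : Fin n, μ j.succ ≪ volume)
    (hsymm : ∀ j : Fin n, (μ j.succ).map (fun z => -z) = μ j.succ) :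
    (Measure.pi μ).real {v | InOpenHalfspace v} = wendelP (n + 1) m := by
  classical
  set S : Set (Fin (n + 1) → Fin m → ℝ) := {v | InOpenHalfspace v} with hS
  have hSm : MeasurableSet S := (isOpen_setOf_inOpenHalfspace m).measurableSet
  let T : (Fin n → ℤˣ) → (Fin (n + 1) → Fin m → ℝ) → (Fin (n + 1) → Fin m → ℝ) :=
    fun ε => signFlip (Fin.cons 1 ε : Fin (n + 1) → ℤˣ)
  have hT : ∀ ε, MeasurePreserving (T ε) (Measure.pi μ) (Measure.pi μ) :=
    measurePreserving_signFlip μ hsymm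
  have hTm : ∀ ε, MeasurableSet (T ε ⁻¹' S) := fun ε => (hT ε).measurable hSm
  -- the number of sign changes bringing the family into a half-space is almost surely constant
  have hcount : ∀ᵐ v ∂Measure.pi μ, ∑ ε, (T ε ⁻¹' S).indicator (fun _ => (1 : ℝ)) v =
      ∑ j ∈ Finset.range m, (n.choose j : ℝ) := by
    filter_upwards [ae_inGeneralPosition μ h0 hac] with v hv
    have h1 := sum_ite_isRegion n (dotProductEquiv ℝ (Fin m) (v 0))
      (fun j : Fin n => dotProductEquiv ℝ (Fin m) (v j.succ)) (by
        convert hv.map (dotProductEquiv ℝ (Fin m)) using 1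
        funext j
        exact Fin.cases rfl (fun j => rfl) j)
    rw [Module.finrank_fin_fun] at h1
    have h2 := congrArg (Nat.cast : ℕ → ℝ) h1
    push_cast at h2
    rw [← h2]
    refine Finset.sum_congr rfl fun ε _ => ?_
    rw [Set.indicator_apply]
    exact if_congr (inOpenHalfspace_signFlip_iff v ε) rfl rfl
  have hsum : ∑ _ε : Fin n → ℤˣ, (Measure.pi μ).real S =
      ∑ j ∈ Finset.range m, (n.choose j : ℝ) := by
    calc ∑ _ε : Fin n → ℤˣ, (Measure.pi μ).real S
        = ∑ ε : Fin n → ℤˣ, ∫ v, (T ε ⁻¹' S).indicator (fun _ => (1 : ℝ)) v ∂Measure.pi μ := by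
          refine Finset.sum_congr rfl fun ε _ => ?_
          rw [integral_indicator_const _ (hTm ε), smul_eq_mul, mul_one, Measure.real,
            Measure.real, (hT ε).measure_preimage hSm.nullMeasurableSet]
      _ = ∫ v, ∑ ε, (T ε ⁻¹' S).indicator (fun _ => (1 : ℝ)) v ∂Measure.pi μ := by
          rw [integral_finsetSum]
          exact fun ε _ => (integrable_const _).indicator (hTm ε)
      _ = ∑ j ∈ Finset.range m, (n.choose j : ℝ) := by
          rw [integral_congr_ae hcount]
          simp
  rw [Finset.sum_const, Finset.card_univ, Fintype.card_fun, Fintype.card_fin,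
    Fintype.card_units_int, nsmul_eq_mul] at hsum
  rw [wendelP, Int.toNat_natCast, Nat.add_sub_cancel, eq_div_iff (by positivity), ← hsum]
  push_cast
  ring

/-! ### Random linear systems -/

theorem wendelP_add_wendelP_sub {n : ℕ} (hn : 1 ≤ n) (d : ℕ) :
    wendelP n d + wendelP n ((n : ℤ) - d) = 1 := by
  obtain ⟨n, rfl⟩ := Nat.exists_eq_add_of_le' hn
  have key : ∑ j ∈ Finset.range d, (n.choose j : ℝ) +
      ∑ j ∈ Finset.range (n + 1 - d), (n.choose j : ℝ) = 2 ^ n := by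
    have hfull : ∑ j ∈ Finset.range (n + 1), (n.choose j : ℝ) = 2 ^ n := by
      exact_mod_cast Nat.sum_range_choose n
    rcases le_total d (n + 1) with hd | hd
    · rw [← hfull, ← Finset.sum_range_add_sum_Ico _ hd, Finset.sum_Ico_eq_sum_range,
        ← Finset.sum_range_reflect (fun j => (n.choose j : ℝ)) (n + 1 - d)]
      congr 1
      refine Finset.sum_congr rfl fun j hj => ?_
      have hj := Finset.mem_range.1 hj
      rw [← Nat.choose_symm_of_eq_add (n := n) (a := d + j) (b := n + 1 - d - 1 - j) (by omega)]
    · rw [Nat.sub_eq_zero_of_le hd, Finset.sum_range_zero, add_zero, ← hfull]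
      refine (Finset.sum_subset (Finset.range_mono hd) fun j _ hj => ?_).symm
      rw [Nat.choose_eq_zero_of_lt (by simpa using hj), Nat.cast_zero]
  have h1 : (((n + 1 : ℕ) : ℤ) - d).toNat = n + 1 - d := by omega
  rw [wendelP, wendelP, h1, Int.toNat_natCast, Nat.add_sub_cancel, ← add_div, key,
    div_self (by positivity)]

theorem HasSymmetricDensity.map_absolutelyContinuous {Ω : Type*} [MeasurableSpace Ω] {m : ℕ}
    {X : Ω → Fin m → ℝ} {P : Measure Ω} (h : HasSymmetricDensity X P) : P.map X ≪ volume := by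
  obtain ⟨-, f, -, -, hf⟩ := h
  rw [hf]
  exact withDensity_absolutelyContinuous _ _

theorem HasSymmetricDensity.map_neg_map {Ω : Type*} [MeasurableSpace Ω] {m : ℕ}
    {X : Ω → Fin m → ℝ} {P : Measure Ω} (h : HasSymmetricDensity X P) :
    (P.map X).map (fun z => -z) = P.map X := by
  obtain ⟨-, f, hfm, hsymm, hf⟩ := h
  rw [hf]
  ext s hs
  rw [Measure.map_apply measurable_neg hs, withDensity_apply _ hs,
    withDensity_apply _ (measurable_neg hs),
    ← (Measure.measurePreserving_neg (volume : Measure (Fin m → ℝ))).setLIntegral_comp_preimage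
      hs hfm]
  simp only [hsymm]

/-- The law of an independent family with one more independent member in front. -/
theorem map_fin_cons_eq_pi {Ω E : Type*} [MeasurableSpace Ω] [MeasurableSpace E] {n : ℕ}
    (P : Measure Ω) [IsProbabilityMeasure P] {b : Ω → E} {z : Ω → Fin n → E} (hb : Measurable b)
    (hz : ∀ j, Measurable fun ω => z ω j) (hindep : iIndepFun (fun j ω => z ω j) P)
    (hbz : IndepFun b z P) :
    P.map (fun ω => (Fin.cons (b ω) (z ω) : Fin (n + 1) → E)) =
      Measure.pi (Fin.cons (P.map b) (fun j => P.map fun ω => z ω j)) := by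
  have hzm : Measurable z := measurable_pi_iff.2 hz
  let μ : Fin (n + 1) → Measure E := Fin.cons (P.map b) (fun j => P.map fun ω => z ω j)
  have hprob : ∀ j, IsProbabilityMeasure (μ j) := by
    refine Fin.cases ?_ fun j => ?_
    · exact Measure.isProbabilityMeasure_map hb.aemeasurable
    · exact Measure.isProbabilityMeasure_map (hz j).aemeasurable
  have h1 := (measurePreserving_piFinSuccAbove μ 0).symm
  have h2 := (indepFun_iff_map_prod_eq_prod_map_map hb.aemeasurable hzm.aemeasurable).1 hbz
  have h3 : P.map z = Measure.pi fun j => P.map fun ω => z ω j :=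
    (iIndepFun_iff_map_fun_eq_pi_map fun j => (hz j).aemeasurable).1 hindep
  rw [h3] at h2
  have h4 := h1.map_eq
  change Measure.map _ ((P.map b).prod (Measure.pi fun j => P.map fun ω => z ω j)) = _ at h4
  rw [← h2, Measure.map_map (MeasurableEquiv.measurable _) (hb.prodMk hzm)] at h4
  convert h4 using 2
  funext ω
  simp [MeasurableEquiv.piFinSuccAbove, Fin.insertNthEquiv]

/-- A random right-hand side that is independent of the matrix: `-b` plays the role of the first
vector in Wendel's theorem. -/
theorem measureReal_hasPositiveSolution {Ω : Type*} [MeasurableSpace Ω] (P : Measure Ω)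
    [IsProbabilityMeasure P] {m n : ℕ} {A : Ω → Matrix (Fin m) (Fin n) ℝ}
    (hdens : ∀ j : Fin n, HasSymmetricDensity (fun ω => (A ω).col j) P)
    (hindep : iIndepFun (fun (j : Fin n) (ω : Ω) => (A ω).col j) P)
    {b : Ω → Fin m → ℝ} (hb : Measurable b) (hb0 : ∀ᵐ ω ∂P, b ω ≠ 0)
    (hbA : IndepFun b (fun ω (j : Fin n) => (A ω).col j) P) :
    P.real {ω | HasPositiveSolution (A ω) (b ω)} = wendelP (n + 1) ((n : ℤ) + 1 - m) := by
  have hcol : ∀ j, Measurable fun ω => (A ω).col j := fun j => (hdens j).1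
  let μ : Fin (n + 1) → Measure (Fin m → ℝ) :=
    Fin.cons (P.map fun ω => -b ω) (fun j => P.map fun ω => (A ω).col j)
  have hprob : ∀ j, IsProbabilityMeasure (μ j) := by
    refine Fin.cases ?_ fun j => ?_
    · exact Measure.isProbabilityMeasure_map hb.neg.aemeasurable
    · exact Measure.isProbabilityMeasure_map (hcol j).aemeasurable
  have hlaw : P.map (fun ω => (Fin.cons (-b ω) (A ω).col : Fin (n + 1) → Fin m → ℝ)) =
      Measure.pi μ :=
    map_fin_cons_eq_pi P hb.neg hcol hindep (hbA.comp measurable_neg measurable_id)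
  have hmeas : Measurable fun ω => (Fin.cons (-b ω) (A ω).col : Fin (n + 1) → Fin m → ℝ) :=
    measurable_pi_iff.2 (Fin.cases hb.neg hcol)
  have hμ0 : μ 0 {0} = 0 := by
    change (P.map fun ω => -b ω) {0} = 0
    rw [Measure.map_apply (f := fun ω => -b ω) hb.neg (measurableSet_singleton 0)]
    refine measure_mono_null (fun ω hω => ?_) (ae_iff.1 hb0)
    simpa using hω
  have hac : ∀ j : Fin n, μ j.succ ≪ volume := fun j => (hdens j).map_absolutelyContinuous
  have hgp := ae_inGeneralPosition μ hμ0 hac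
  rw [← hlaw] at hgp
  have hcongr : ∀ᵐ ω ∂P, HasPositiveSolution (A ω) (b ω) ↔
      ¬ InOpenHalfspace (Fin.cons (-b ω) (A ω).col : Fin (n + 1) → Fin m → ℝ) := by
    filter_upwards [hb0, ae_of_ae_map hmeas.aemeasurable hgp] with ω h1 h2
    refine hasPositiveSolution_iff ?_ h1
    simpa [Function.comp_def] using h2.comp (Fin.succ_injective n)
  have hS := (isOpen_setOf_inOpenHalfspace (ι := Fin (n + 1)) m).measurableSet
  have hW := measureReal_inOpenHalfspace μ hμ0 hac fun j => (hdens j).map_neg_map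
  rw [← hlaw, map_measureReal_apply hmeas hS] at hW
  have hpos : P.real {ω | HasPositiveSolution (A ω) (b ω)} =
      P.real {ω | ¬ InOpenHalfspace (Fin.cons (-b ω) (A ω).col : Fin (n + 1) → Fin m → ℝ)} :=
    measureReal_congr (Filter.eventuallyEq_set.2 hcongr)
  have h1 := wendelP_add_wendelP_sub (Nat.le_add_left 1 n) m
  push_cast at h1
  calc P.real {ω | HasPositiveSolution (A ω) (b ω)}
      = 1 - P.real ((fun ω => (Fin.cons (-b ω) (A ω).col : Fin (n + 1) → Fin m → ℝ)) ⁻¹'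
          {v | InOpenHalfspace v}) := hpos.trans (probReal_compl_eq_one_sub (hmeas hS))
    _ = wendelP (n + 1) ((n : ℤ) + 1 - m) := by
      rw [hW]
      linarith

theorem mainTheorem4 {Ω : Type*} [MeasurableSpace Ω] (P : Measure Ω) [IsProbabilityMeasure P]
    (m n : ℕ) (hm : 1 ≤ m) (hn : 1 ≤ n)
    (A : Ω → Matrix (Fin m) (Fin n) ℝ)
    (hdens : ∀ j : Fin n, HasSymmetricDensity (fun ω => (A ω).col j) P)
    (hindep : iIndepFun (fun (j : Fin n) (ω : Ω) => (A ω).col j) P) :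
    -- `p(n,m)` is the probability that the convex hull of the columns misses the origin
    P.real {ω | (0 : Fin m → ℝ) ∉ convexHull ℝ (Set.range fun j : Fin n => (A ω).col j)}
        = wendelP n m ∧
    -- the homogeneous system
    P.real {ω | HasPositiveSolution (A ω) 0} = wendelP n ((n : ℤ) - m) ∧
    -- a fixed nonzero right-hand side
    (∀ b : Fin m → ℝ, b ≠ 0 →
      P.real {ω | HasPositiveSolution (A ω) b} = wendelP (n + 1) ((n : ℤ) + 1 - m)) ∧
    -- a random nonzero right-hand side, independent of the matrix
    (∀ b : Ω → (Fin m → ℝ), Measurable b → (∀ᵐ ω ∂P, b ω ≠ 0) →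
      IndepFun b (fun ω (j : Fin n) => (A ω).col j) P →
      P.real {ω | HasPositiveSolution (A ω) (b ω)} = wendelP (n + 1) ((n : ℤ) + 1 - m)) := by
  have hcol : ∀ j, Measurable fun ω => (A ω).col j := fun j => (hdens j).1
  have hAm : Measurable fun ω => (A ω).col := measurable_pi_iff.2 hcol
  have hS : MeasurableSet {v : Fin n → Fin m → ℝ | InOpenHalfspace v} :=
    (isOpen_setOf_inOpenHalfspace m).measurableSet
  have hW : P.real {ω | InOpenHalfspace (A ω).col} = wendelP n m := by
    obtain ⟨n, rfl⟩ := Nat.exists_eq_add_of_le' hn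
    have hprob : ∀ j, IsProbabilityMeasure (P.map fun ω => (A ω).col j) := fun j =>
      Measure.isProbabilityMeasure_map (hcol j).aemeasurable
    -- Lebesgue measure on `ℝ^m` has no atoms only for `m ≥ 1`
    have hnonempty : Nonempty (Fin m) := ⟨⟨0, hm⟩⟩
    have h := measureReal_inOpenHalfspace (fun j => P.map fun ω => (A ω).col j)
      ((hdens 0).map_absolutelyContinuous (measure_singleton 0))
      (fun j => (hdens j.succ).map_absolutelyContinuous) fun j => (hdens j.succ).map_neg_map
    rw [← (iIndepFun_iff_map_fun_eq_pi_map fun j => (hcol j).aemeasurable).1 hindep,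
      map_measureReal_apply hAm hS] at h
    exact h
  refine ⟨?_, ?_, fun b hb => ?_, fun b hb hb0 hbA => ?_⟩
  · rw [← hW]
    congr 1
    ext ω
    exact zero_notMem_convexHull_iff (A ω)
  · simp only [hasPositiveSolution_zero_iff]
    calc P.real {ω | ¬ InOpenHalfspace (A ω).col}
        = 1 - P.real {ω | InOpenHalfspace (A ω).col} := probReal_compl_eq_one_sub (hAm hS)
      _ = wendelP n ((n : ℤ) - m) := by
        rw [hW]
        linarith [wendelP_add_wendelP_sub hn m]
  · exact measureReal_hasPositiveSolution P hdens hindep measurable_const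
      (Filter.Eventually.of_forall fun _ => hb) (indepFun_const_left b _)
  · exact measureReal_hasPositiveSolution P hdens hindep hb hb0 hbA
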